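/- A multiplicative Lie algebra is a (not necessarily abelian) group $G$ with a second operation $\star$ such that, with ${}^xy=xyx^{-1}$, for all $x,y,z\in G$: $x\star x=1$; $x\star(yz)=(x\star y)\,{}^y(x\star z)$; $(xy)\star z={}^x(y\star z)\,(x\star z)$; $((x\star y)\star{}^yz)((y\star z)\star{}^zx)((z\star x)\star{}^xy)=1$; ${}^z(x\star y)={}^zx\star{}^zy$. Its ideals are the normal subgroups $H$ with $x\star y\in H$ for all $x\in G$, $y\in H$. Put ${}^M[G,G]=(G\star G)[G,G]$, where $G\star G$ is the ideal generated by all $a\star b$ ($a,b\in G$), let $Z(G)$ be the center of the group $G$ and $LZ(G)=\{x\in G: x\star y=1 \text{ for all } y\in G\}$. An exact sequence $1\to N\to G^*\to G\to 1$ of multiplicative Lie algebras is a central extension if (the image of) $N$ lies in $Z(G^*)\cap LZ(G^*)$, and a stem extension if moreover $N\subseteq{}^M[G^*,G^*]$. For an abelian group $A$, let $Z^2_{ML}(G,A)$ be the group, under pointwise multiplication, of multiplicative Lie 2-cocycles, i.e. of the pairs of maps $\gamma,\xi:G\times G\to A$ with $\gamma(1,x)=\gamma(x,1)=1$ for all $x$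 such that the set $A\times G$ with the operations $$(a,x)(b,y)=(ab\,\gamma(x,y),\,xy),\qquad (a,x)\star(b,y)=(\xi(x,y),\,x\star y)$$ is a multiplicative Lie algebra; this multiplicative Lie algebra, with $a\mapsto(a,1)$ and $(a,x)\mapsto x$, is the extension associated with $(\gamma,\xi)$. Let $B^2_{ML}(G,A)$ be the subgroup of the pairs $\gamma(x,y)=g(x)g(y)g(xy)^{-1}$, $\xi(x,y)=g(x\star y)^{-1}$ with $g:G\to A$, $g(1)=1$, and put $H^2_{ML}(G,A)=Z^2_{ML}(G,A)/B^2_{ML}(G,A)$. The Schur multiplier of a finite multiplicative Lie algebra $G$ is $\tilde M(G)=H^2_{ML}(G,\mathbb C^*)$. A cover of $G$ is a multiplicative Lie algebra $G^*$ for which there is a stem extension $1\to N\to G^*\to G\to1$ with $N\cong\tilde M(G)$. **Theorem.** Every finite multiplicative Lie algebra $G$ has at least one cover $G^*$. More precisely, there are integers $m\ge0$ and $d_1,\dots,d_m\ge1$ and, with $A=A_1\times\cdots\times A_m$ where $A_i$ is the group of $d_i$-th roots of unity in $\mathbb C^*$, a multiplicative Lie 2-cocycle $(\gamma,\xi)$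 of $G$ with values in $A$, such that the associated extension $1\to A\to G^*\to G\to 1$ is a stem extension with $A\cong\tilde M(G)$. -/

import Mathlib

universe u v w

/-- A multiplicative Lie algebra: a (not necessarily abelian) group with a second operation `⋆`
satisfying the five identities below; the left conjugate of `y` by `x` is `x * y * x⁻¹`. -/
class MultLieAlgebra (G : Type u) extends Group G where
  /-- the multiplicative Lie product -/
  lieProd : G → G → G
  lieProd_self : ∀ x : G, lieProd x x = 1
  lieProd_mul : ∀ x y z : G, lieProd x (y * z) = lieProd x y * (y * lieProd x z * y⁻¹)
  mul_lieProd : ∀ x y z : G, lieProd (x * y) z = (x * lieProd y z * x⁻¹) * lieProd x z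
  jacobi : ∀ x y z : G,
    lieProd (lieProd x y) (y * z * y⁻¹) * lieProd (lieProd y z) (z * x * z⁻¹) *
      lieProd (lieProd z x) (x * y * x⁻¹) = 1
  conj_lieProd : ∀ x y z : G,
    z * lieProd x y * z⁻¹ = lieProd (z * x * z⁻¹) (z * y * z⁻¹)

infixl:75 " ⋆ " => MultLieAlgebra.lieProd

namespace MultLieAlgebra

section Basic

variable {G : Type u} [MultLieAlgebra G]

theorem one_lieProd (y : G) : (1 : G) ⋆ y = 1 := by
  simpa using mul_lieProd (1 : G) 1 y

theorem lieProd_one (x : G) : x ⋆ (1 : G) = 1 := by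
  simpa using lieProd_mul x (1 : G) 1

/-- Ideals: normal subgroups `H` such that `x ⋆ y ∈ H` for all `x ∈ G` and `y ∈ H`. -/
structure IsIdeal (H : Subgroup G) : Prop where
  normal : H.Normal
  lieProd_mem : ∀ x : G, ∀ y ∈ H, x ⋆ y ∈ H

variable (G)

/-- `G ⋆ G`, the ideal of `G` generated by all the products `a ⋆ b`. -/
def lieSquare : Subgroup G :=
  sInf {H : Subgroup G | IsIdeal H ∧ ∀ a b : G, a ⋆ b ∈ H}

/-- `ᴹ[G, G] = (G ⋆ G)[G, G]`, the product of `G ⋆ G` and the commutator subgroup. -/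
def mlDerived : Subgroup G := lieSquare G ⊔ commutator G

/-- The Lie center `LZ(G) = {x | x ⋆ y = 1 for all y}`. -/
def lieCenter : Subgroup G where
  carrier := {x | ∀ y : G, x ⋆ y = 1}
  one_mem' := one_lieProd
  mul_mem' := by
    intro a b ha hb y
    rw [mul_lieProd, ha y, hb y]
    simp
  inv_mem' := by
    intro a ha y
    have h := mul_lieProd a⁻¹ a y
    rw [inv_mul_cancel, one_lieProd, ha y] at h
    simpa using h.symm

end Basic

/-- Homomorphisms of multiplicative Lie algebras. -/
structure Hom (E : Type u) (G : Type v) [MultLieAlgebra E] [MultLieAlgebra G]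
    extends MonoidHom E G where
  map_lieProd' : ∀ x y : E, toFun (x ⋆ y) = toFun x ⋆ toFun y

section Cocycles

variable (G : Type u) [MultLieAlgebra G] (A : Type v) [CommGroup A]

/-- For `γ : G × G → A`, the `A`-component of the conjugate of `(1, y)` by `(1, x)` in the central
extension of groups defined by `γ`. -/
def conjFactor {G : Type u} [MultLieAlgebra G] {A : Type v} [CommGroup A]
    (γ : G → G → A) (x y : G) : A :=
  γ x y * (γ (x * y * x⁻¹) x)⁻¹

/-- Multiplicative Lie 2-cocycles `(γ, ξ)` of `G` with values in the abelian group `A` (with trivial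
Lie product and trivial action): `γ` is a normalized group 2-cocycle, and the remaining identities
are the ones which say that the operations
`(a, x)(b, y) = (a b γ(x, y), x y)` and `(a, x) ⋆ (b, y) = (ξ(x, y), x ⋆ y)`
on `A × G` satisfy the five axioms of a multiplicative Lie algebra, in their order. -/
structure IsCocycle {G : Type u} [MultLieAlgebra G] {A : Type v} [CommGroup A]
    (γ ξ : G → G → A) : Prop where
  one_left : ∀ x : G, γ 1 x = 1
  one_right : ∀ x : G, γ x 1 = 1
  assoc : ∀ x y z : G, γ x y * γ (x * y) z = γ y z * γ x (y * z)
  self : ∀ x : G, ξ x x = 1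
  mul_right : ∀ x y z : G,
    ξ x (y * z) =
      ξ x y * (ξ x z * conjFactor γ y (x ⋆ z)) * γ (x ⋆ y) (y * (x ⋆ z) * y⁻¹)
  mul_left : ∀ x y z : G,
    ξ (x * y) z =
      (ξ y z * conjFactor γ x (y ⋆ z)) * ξ x z * γ (x * (y ⋆ z) * x⁻¹) (x ⋆ z)
  jacobi : ∀ x y z : G,
    ξ (x ⋆ y) (y * z * y⁻¹) * ξ (y ⋆ z) (z * x * z⁻¹) *
        γ ((x ⋆ y) ⋆ (y * z * y⁻¹)) ((y ⋆ z) ⋆ (z * x * z⁻¹)) *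
      ξ (z ⋆ x) (x * y * x⁻¹) *
        γ (((x ⋆ y) ⋆ (y * z * y⁻¹)) * ((y ⋆ z) ⋆ (z * x * z⁻¹)))
          ((z ⋆ x) ⋆ (x * y * x⁻¹)) = 1
  conj : ∀ x y z : G,
    ξ x y * conjFactor γ z (x ⋆ y) = ξ (z * x * z⁻¹) (z * y * z⁻¹)

/-- The group `Z²_ML(G, A)` of multiplicative Lie 2-cocycles under pointwise multiplication. -/
def Z2 : Subgroup ((G → G → A) × (G → G → A)) where
  carrier := {c | IsCocycle c.1 c.2}
  one_mem' := by
    constructor <;> simp [conjFactor]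
  mul_mem' := by
    rintro ⟨γ, ξ⟩ ⟨γ', ξ'⟩ h h'
    have h : IsCocycle γ ξ := h
    have h' : IsCocycle γ' ξ' := h'
    change IsCocycle (γ * γ') (ξ * ξ')
    constructor
    · intro x; simp [h.one_left, h'.one_left]
    · intro x; simp [h.one_right, h'.one_right]
    · intro x y z
      have e := congrArg₂ (· * ·) (h.assoc x y z) (h'.assoc x y z)
      simp only [Pi.mul_apply] at e ⊢
      calc _ = _ := by ac_rfl
        _ = _ := e
        _ = _ := by ac_rfl
    · intro x; simp [h.self, h'.self]
    · intro x y z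
      have e := congrArg₂ (· * ·) (h.mul_right x y z) (h'.mul_right x y z)
      simp only [Pi.mul_apply, conjFactor, mul_inv] at e ⊢
      calc _ = _ := e
        _ = _ := by ac_rfl
    · intro x y z
      have e := congrArg₂ (· * ·) (h.mul_left x y z) (h'.mul_left x y z)
      simp only [Pi.mul_apply, conjFactor, mul_inv] at e ⊢
      calc _ = _ := e
        _ = _ := by ac_rfl
    · intro x y z
      have e := congrArg₂ (· * ·) (h.jacobi x y z) (h'.jacobi x y z)
      simp only [Pi.mul_apply, mul_one] at e ⊢
      calc _ = _ := by ac_rfl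
        _ = _ := e
    · intro x y z
      have e := congrArg₂ (· * ·) (h.conj x y z) (h'.conj x y z)
      simp only [Pi.mul_apply, conjFactor, mul_inv] at e ⊢
      calc _ = _ := by ac_rfl
        _ = _ := e
  inv_mem' := by
    rintro ⟨γ, ξ⟩ h
    have h : IsCocycle γ ξ := h
    change IsCocycle γ⁻¹ ξ⁻¹
    constructor
    · intro x; simp [h.one_left]
    · intro x; simp [h.one_right]
    · intro x y z
      have e := congrArg (·⁻¹) (h.assoc x y z)
      simpa only [Pi.inv_apply, mul_inv] using e
    · intro x; simp [h.self]
    · intro x y z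
      have e := congrArg (·⁻¹) (h.mul_right x y z)
      simpa only [Pi.inv_apply, conjFactor, mul_inv] using e
    · intro x y z
      have e := congrArg (·⁻¹) (h.mul_left x y z)
      simpa only [Pi.inv_apply, conjFactor, mul_inv] using e
    · intro x y z
      have e := congrArg (·⁻¹) (h.jacobi x y z)
      simpa only [Pi.inv_apply, mul_inv, inv_one] using e
    · intro x y z
      have e := congrArg (·⁻¹) (h.conj x y z)
      simpa only [Pi.inv_apply, conjFactor, mul_inv] using e

/-- The coboundaries: the pairs `γ(x, y) = g(x) g(y) g(xy)⁻¹`, `ξ(x, y) = g(x ⋆ y)⁻¹` for a map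
`g : G → A` with `g(1) = 1`, i.e. the effect of a change of section on a cocycle. -/
def B2 : Subgroup ((G → G → A) × (G → G → A)) where
  carrier := {c | ∃ g : G → A, g 1 = 1 ∧
    (∀ x y : G, c.1 x y = g x * g y * (g (x * y))⁻¹) ∧
    (∀ x y : G, c.2 x y = (g (x ⋆ y))⁻¹)}
  one_mem' := ⟨fun _ => 1, rfl, by simp, by simp⟩
  mul_mem' := by
    rintro c c' ⟨g, h1, h2, h3⟩ ⟨g', h1', h2', h3'⟩
    refine ⟨g * g', by simp [h1, h1'], fun x y => ?_, fun x y => ?_⟩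
    · simp only [Prod.fst_mul, Pi.mul_apply, h2, h2', mul_inv]
      ac_rfl
    · simp only [Prod.snd_mul, Pi.mul_apply, h3, h3', mul_inv]
  inv_mem' := by
    rintro c ⟨g, h1, h2, h3⟩
    refine ⟨g⁻¹, by simp [h1], fun x y => ?_, fun x y => ?_⟩
    · simp only [Prod.fst_inv, Pi.inv_apply, h2, mul_inv]
    · simp only [Prod.snd_inv, Pi.inv_apply, h3]

/-- The second cohomology group `H²_ML(G, A) = Z²_ML(G, A) / B²_ML(G, A)`. -/
abbrev H2 : Type (max u v) := Z2 G A ⧸ (B2 G A).subgroupOf (Z2 G A)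

/-- The Schur multiplier `M̃(G) = H²_ML(G, ℂˣ)`. -/
abbrev SchurMultiplier : Type u := H2 G ℂˣ

end Cocycles

section Extension

variable {G : Type u} [MultLieAlgebra G] {A : Type v} [CommGroup A]

/-- The underlying set `A × G` of the extension of `G` by `A` associated with a cocycle. -/
@[ext] structure Ext (c : Z2 G A) : Type (max u v) where
  fib : A
  base : G

namespace Ext

variable (c : Z2 G A)

theorem isCocycle : IsCocycle c.1.1 c.1.2 := c.2

theorem inv_symm (x : G) : c.1.1 x⁻¹ x = c.1.1 x x⁻¹ := by
  have h := (isCocycle c).assoc x x⁻¹ x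
  simpa [(isCocycle c).one_left, (isCocycle c).one_right] using h.symm

instance instGroup : Group (Ext c) where
  mul p q := ⟨p.fib * q.fib * c.1.1 p.base q.base, p.base * q.base⟩
  one := ⟨1, 1⟩
  inv p := ⟨p.fib⁻¹ * (c.1.1 p.base p.base⁻¹)⁻¹, p.base⁻¹⟩
  mul_assoc p q r := by
    refine Ext.ext ?_ (mul_assoc p.base q.base r.base)
    change p.fib * q.fib * c.1.1 p.base q.base * r.fib * c.1.1 (p.base * q.base) r.base =
      p.fib * (q.fib * r.fib * c.1.1 q.base r.base) * c.1.1 p.base (q.base * r.base)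
    have h := (isCocycle c).assoc p.base q.base r.base
    calc _ = p.fib * q.fib * r.fib *
          (c.1.1 p.base q.base * c.1.1 (p.base * q.base) r.base) := by ac_rfl
      _ = _ := by rw [h]; ac_rfl
  one_mul p := by
    refine Ext.ext ?_ (one_mul p.base)
    change 1 * p.fib * c.1.1 1 p.base = p.fib
    simp [(isCocycle c).one_left]
  mul_one p := by
    refine Ext.ext ?_ (mul_one p.base)
    change p.fib * 1 * c.1.1 p.base 1 = p.fib
    simp [(isCocycle c).one_right]
  inv_mul_cancel p := by
    refine Ext.ext ?_ (inv_mul_cancel p.base)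
    change p.fib⁻¹ * (c.1.1 p.base p.base⁻¹)⁻¹ * p.fib * c.1.1 p.base⁻¹ p.base = 1
    rw [inv_symm, mul_right_comm p.fib⁻¹]
    simp

@[simp] theorem mul_fib (p q : Ext c) :
    (p * q).fib = p.fib * q.fib * c.1.1 p.base q.base := rfl

@[simp] theorem mul_base (p q : Ext c) : (p * q).base = p.base * q.base := rfl

@[simp] theorem one_fib : (1 : Ext c).fib = 1 := rfl

@[simp] theorem one_base : (1 : Ext c).base = 1 := rfl

@[simp] theorem inv_base (p : Ext c) : (p⁻¹).base = p.base⁻¹ := rfl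

theorem conj_eq (p q : Ext c) :
    p * q * p⁻¹ =
      ⟨q.fib * conjFactor c.1.1 p.base q.base, p.base * q.base * p.base⁻¹⟩ := by
  rw [mul_inv_eq_iff_eq_mul]
  refine Ext.ext ?_ ?_
  · simp only [mul_fib, conjFactor]
    calc _ = q.fib * c.1.1 p.base q.base * p.fib := by ac_rfl
      _ = q.fib * (c.1.1 p.base q.base * (c.1.1 (p.base * q.base * p.base⁻¹) p.base)⁻¹ *
          c.1.1 (p.base * q.base * p.base⁻¹) p.base) * p.fib := by
        rw [inv_mul_cancel_right]
      _ = _ := by ac_rfl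
  · simp

/-- The extension of `G` by `A` associated with a cocycle `(γ, ξ)`: the set `A × G` with
`(a, x)(b, y) = (a b γ(x, y), x y)` and `(a, x) ⋆ (b, y) = (ξ(x, y), x ⋆ y)`. -/
instance instMultLieAlgebra : MultLieAlgebra (Ext c) where
  lieProd p q := ⟨c.1.2 p.base q.base, p.base ⋆ q.base⟩
  lieProd_self p := Ext.ext ((isCocycle c).self p.base) (lieProd_self p.base)
  lieProd_mul p q r := by
    rw [conj_eq]
    exact Ext.ext ((isCocycle c).mul_right p.base q.base r.base)
      (lieProd_mul p.base q.base r.base)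
  mul_lieProd p q r := by
    rw [conj_eq]
    exact Ext.ext ((isCocycle c).mul_left p.base q.base r.base)
      (mul_lieProd p.base q.base r.base)
  jacobi p q r := Ext.ext ((isCocycle c).jacobi p.base q.base r.base)
      (MultLieAlgebra.jacobi p.base q.base r.base)
  conj_lieProd p q r := by
    rw [conj_eq]
    exact Ext.ext ((isCocycle c).conj p.base q.base r.base)
      (conj_lieProd p.base q.base r.base)

/-- The inclusion `a ↦ (a, 1)`. -/
def incl : A →* Ext c where
  toFun a := ⟨a, 1⟩
  map_one' := rfl
  map_mul' a b := Ext.ext (by simp [(isCocycle c).one_left]) (by simp)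

/-- The projection `(a, x) ↦ x`. -/
def proj : Hom (Ext c) G where
  toFun p := p.base
  map_one' := rfl
  map_mul' _ _ := rfl
  map_lieProd' _ _ := rfl

end Ext

end Extension

section Covers

variable {N : Type w} [Group N] {E : Type v} [MultLieAlgebra E] {G : Type u} [MultLieAlgebra G]

/-- `1 → N → E → G → 1` is a central extension of multiplicative Lie algebras: an exact sequence
with the image of `N` in `Z(E) ∩ LZ(E)`. (As the image lies in the Lie center, the Lie product that
`N` has as an ideal of `E` is the trivial one, so that `N` is just a group here.) -/
structure IsCentralExtension (ι : N →* E) (φ : Hom E G) : Prop where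
  injective : Function.Injective ι
  surjective : Function.Surjective φ.toMonoidHom
  exact : ι.range = φ.toMonoidHom.ker
  central : ι.range ≤ Subgroup.center E ⊓ lieCenter E

/-- Stem extensions: central extensions with the image of `N` contained in `ᴹ[E, E]`. -/
structure IsStemExtension (ι : N →* E) (φ : Hom E G) : Prop
    extends IsCentralExtension ι φ where
  stem : ι.range ≤ mlDerived E

/-- Stem covers: stem extensions with `N` isomorphic to the Schur multiplier of `G`. -/
structure IsStemCover (ι : N →* E) (φ : Hom E G) : Prop
    extends IsStemExtension ι φ where
  iso : Nonempty (N ≃* SchurMultiplier G)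

end Covers

end MultLieAlgebra

/-!
The proof is Schur's. The `|G|`-th power of the group part of a cocycle with values in `ℂˣ` is a
coboundary, and once the group part is trivial the Lie part is multiplicative in each variable;
hence `M̃(G)` has exponent dividing `|G|²` (`schurMultiplier_pow_eq_one`). Since `ℂˣ` is divisible,
so is the group of coboundaries, and a class of exponent `n` is represented by a cocycle `c` with
`c ^ n = 1`, that is, one with values in the `n`-th roots of unity (`exists_cocycle_pow_eq_one`).
In particular `M̃(G)` is finite, so it is a product of cyclic groups of orders `d i`, with
generators `h i`.

Representing each `h i` by a cocycle with values in the `d i`-th roots of unity gives a cocycle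
`c` with values in the product `A ≅ M̃(G)` of these groups of roots of unity. A character `χ` of `A`
has the form `a ↦ ∏ i, a i ^ k i`, so the class of `χ ∘ c` is `∏ i, h i ^ k i`, which is trivial only
if `χ` is. On the other hand, a character of `G*` that is trivial on `ᴹ[G*, G*]` restricts to a
character `χ` of `A` for which `χ ∘ c` is a coboundary (`comp_incl_mem_B2`). So every character of
the finite abelian group `G* / ᴹ[G*, G*]` is trivial on the image of `A`, which means that
`A ≤ ᴹ[G*, G*]` (`isStemExtension_ext`).
-/

open MultLieAlgebra

/-! ### Cocycles and coboundaries -/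

/-- A family of homomorphisms that jointly separates the points of `A` detects cocycles. -/
theorem isCocycle_of_forall_comp {G : Type*} [MultLieAlgebra G] {A B ι : Type*} [CommGroup A]
    [CommGroup B] (f : ι → A →* B) (hf : ∀ a b : A, (∀ i, f i a = f i b) → a = b)
    {γ ξ : G → G → A}
    (h : ∀ i, IsCocycle (fun x y => f i (γ x y)) (fun x y => f i (ξ x y))) :
    IsCocycle γ ξ where
  one_left x := hf _ _ fun i => by simpa using (h i).one_left x
  one_right x := hf _ _ fun i => by simpa using (h i).one_right x
  assoc x y z := hf _ _ fun i => by simpa using (h i).assoc x y z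
  self x := hf _ _ fun i => by simpa using (h i).self x
  mul_right x y z := hf _ _ fun i => by simpa [conjFactor] using (h i).mul_right x y z
  mul_left x y z := hf _ _ fun i => by simpa [conjFactor] using (h i).mul_left x y z
  jacobi x y z := hf _ _ fun i => by simpa using (h i).jacobi x y z
  conj x y z := hf _ _ fun i => by simpa [conjFactor] using (h i).conj x y z

/-- Coboundaries are cocycles. -/
theorem B2_le_Z2 (G : Type*) [MultLieAlgebra G] (A : Type*) [CommGroup A] :
    B2 G A ≤ Z2 G A := by
  rintro ⟨γ, ξ⟩ ⟨g, h1, hγ, hξ⟩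
  simp only at hγ hξ
  have hc : ∀ x y, conjFactor γ x y = g y * (g (x * y * x⁻¹))⁻¹ := by
    intro x y
    rw [conjFactor, hγ, hγ, inv_mul_cancel_right]
    apply Additive.ofMul.injective
    simp only [ofMul_mul, ofMul_inv]
    abel
  refine (?_ : IsCocycle γ ξ)
  constructor
  · intro x; simp [hγ, h1]
  · intro x; simp [hγ, h1]
  · intro x y z
    rw [hγ, hγ, hγ, hγ, mul_assoc x y z]
    apply Additive.ofMul.injective
    simp only [ofMul_mul, ofMul_inv]
    abel
  · intro x; rw [hξ, lieProd_self, h1, inv_one]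
  · intro x y z
    rw [hc, hγ, hξ, hξ, hξ, ← lieProd_mul]
    apply Additive.ofMul.injective
    simp only [ofMul_mul, ofMul_inv]
    abel
  · intro x y z
    rw [hc, hγ, hξ, hξ, hξ, ← mul_lieProd]
    apply Additive.ofMul.injective
    simp only [ofMul_mul, ofMul_inv]
    abel
  · intro x y z
    rw [hγ, hγ, hξ, hξ, hξ, MultLieAlgebra.jacobi, h1]
    apply Additive.ofMul.injective
    simp only [ofMul_mul, ofMul_inv, ofMul_one]
    abel
  · intro x y z
    rw [hc, hξ, hξ, ← conj_lieProd]
    apply Additive.ofMul.injective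
    simp only [ofMul_mul, ofMul_inv]
    abel

/-! ### Finiteness of the Schur multiplier -/

theorem Complex.exists_units_pow_eq (u : ℂˣ) {n : ℕ} (hn : n ≠ 0) : ∃ v : ℂˣ, v ^ n = u := by
  obtain ⟨z, hz⟩ := IsAlgClosed.exists_pow_nat_eq (u : ℂ) (Nat.pos_of_ne_zero hn)
  have hz0 : z ≠ 0 := by
    rintro rfl
    exact u.ne_zero (by rw [← hz, zero_pow hn])
  exact ⟨Units.mk0 z hz0, Units.ext (by simpa using hz)⟩

/-- The group of coboundaries with values in `ℂˣ` is divisible: take roots of `g` pointwise. -/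
theorem exists_mem_B2_pow_eq {G : Type*} [MultLieAlgebra G]
    {b : (G → G → ℂˣ) × (G → G → ℂˣ)} (hb : b ∈ B2 G ℂˣ) {n : ℕ} (hn : n ≠ 0) :
    ∃ b' ∈ B2 G ℂˣ, b' ^ n = b := by
  obtain ⟨g, h1, hγ, hξ⟩ := hb
  have hroot : ∀ u : ℂˣ, ∃ v : ℂˣ, v ^ n = u ∧ (u = 1 → v = 1) := by
    intro u
    by_cases hu : u = 1
    · exact ⟨1, by simp [hu], fun _ => rfl⟩
    · obtain ⟨v, hv⟩ := Complex.exists_units_pow_eq u hn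
      exact ⟨v, hv, fun h => absurd h hu⟩
  choose r hr hr1 using hroot
  refine ⟨(fun x y => r (g x) * r (g y) * (r (g (x * y)))⁻¹, fun x y => (r (g (x ⋆ y)))⁻¹),
    ⟨fun x => r (g x), hr1 _ h1, fun _ _ => rfl, fun _ _ => rfl⟩, ?_⟩
  refine Prod.ext (funext₂ fun x y => ?_) (funext₂ fun x y => ?_)
  · simp [mul_pow, hr, hγ]
  · simp [hr, hξ]

/-- As the coboundaries are divisible, a cohomology class whose `n`-th power is trivial is
represented by a cocycle whose `n`-th power is trivial. -/
theorem exists_cocycle_pow_eq_one {G : Type*} [MultLieAlgebra G] (h : SchurMultiplier G)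
    {n : ℕ} (hn : n ≠ 0) (hh : h ^ n = 1) :
    ∃ c : Z2 G ℂˣ, (QuotientGroup.mk c : SchurMultiplier G) = h ∧ c ^ n = 1 := by
  obtain ⟨z, rfl⟩ := QuotientGroup.mk_surjective h
  rw [← QuotientGroup.mk_pow, QuotientGroup.eq_one_iff, Subgroup.mem_subgroupOf] at hh
  obtain ⟨b, hb, hbn⟩ := exists_mem_B2_pow_eq hh hn
  refine ⟨z * ⟨b, B2_le_Z2 _ _ hb⟩⁻¹, ?_, ?_⟩
  · rw [QuotientGroup.eq, Subgroup.mem_subgroupOf]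
    simpa using hb
  · rw [mul_pow, inv_pow, mul_inv_eq_one]
    exact Subtype.ext hbn.symm

/-- A power of the cocycle `(γ, ξ)` is cohomologous to one with trivial group part: the `|G|`-th
power of `γ` is the coboundary of `x ↦ ∏ z, γ (x, z)`. When the group part is trivial, `ξ` is
multiplicative in its second argument, so that its `|G|`-th power is trivial. -/
theorem schurMultiplier_pow_eq_one {G : Type*} [MultLieAlgebra G] [Finite G]
    (h : SchurMultiplier G) : h ^ (Nat.card G * Nat.card G) = 1 := by
  have := Fintype.ofFinite G
  obtain ⟨c, rfl⟩ := QuotientGroup.mk_surjective h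
  have hc : IsCocycle c.1.1 c.1.2 := c.2
  let g : G → ℂˣ := fun x => ∏ z, c.1.1 x z
  have hg1 : g 1 = 1 := by simp [g, hc.one_left]
  have hg : ∀ x y, c.1.1 x y ^ Nat.card G = g x * g y * (g (x * y))⁻¹ := by
    intro x y
    have e : ∏ z, (c.1.1 x y * c.1.1 (x * y) z) = ∏ z, (c.1.1 y z * c.1.1 x (y * z)) :=
      Finset.prod_congr rfl fun z _ => hc.assoc x y z
    rw [Finset.prod_mul_distrib, Finset.prod_mul_distrib, Finset.prod_const, Finset.card_univ,
      ← Nat.card_eq_fintype_card] at e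
    have hx : ∏ z, c.1.1 x (y * z) = g x := Equiv.prod_comp (Equiv.mulLeft y) (fun z => c.1.1 x z)
    rw [hx] at e
    rw [eq_mul_inv_iff_mul_eq]
    exact e.trans (mul_comm _ _)
  let b : Z2 G ℂˣ := ⟨(fun x y => g x * g y * (g (x * y))⁻¹, fun x y => (g (x ⋆ y))⁻¹),
    B2_le_Z2 _ _ ⟨g, hg1, fun _ _ => rfl, fun _ _ => rfl⟩⟩
  have hb : b ∈ (B2 G ℂˣ).subgroupOf (Z2 G ℂˣ) :=
    Subgroup.mem_subgroupOf.2 ⟨g, hg1, fun _ _ => rfl, fun _ _ => rfl⟩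
  let c' : Z2 G ℂˣ := c ^ Nat.card G * b⁻¹
  have hc' : IsCocycle c'.1.1 c'.1.2 := c'.2
  have hγ' : ∀ x y, c'.1.1 x y = 1 := by
    intro x y
    change c.1.1 x y ^ Nat.card G * (g x * g y * (g (x * y))⁻¹)⁻¹ = 1
    rw [hg, mul_inv_cancel]
  have hξ' : ∀ x y, c'.1.2 x y ^ Nat.card G = 1 := by
    intro x y
    let f : G →* ℂˣ := MonoidHom.mk' (c'.1.2 x) fun y z => by
      simpa [conjFactor, hγ'] using hc'.mul_right x y z
    change f y ^ Nat.card G = 1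
    rw [← map_pow, pow_card_eq_one', map_one]
  have hpow : c' ^ Nat.card G = 1 := by
    refine Subtype.ext (Prod.ext (funext₂ fun x y => ?_) (funext₂ fun x y => ?_))
    · change c'.1.1 x y ^ Nat.card G = 1
      rw [hγ', one_pow]
    · exact hξ' x y
  have hmk : (QuotientGroup.mk c' : SchurMultiplier G) = QuotientGroup.mk c ^ Nat.card G := by
    have : c'⁻¹ * c ^ Nat.card G = b := by
      rw [mul_inv_rev, inv_inv, inv_mul_cancel_right]
    rw [← QuotientGroup.mk_pow, QuotientGroup.eq, this]
    exact hb
  rw [pow_mul, ← hmk, ← QuotientGroup.mk_pow, hpow, QuotientGroup.mk_one]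

/-- Every class is represented by a cocycle with values in the `|G|²`-th roots of unity, and there
are finitely many of these. -/
instance finite_schurMultiplier (G : Type*) [MultLieAlgebra G] [Finite G] :
    Finite (SchurMultiplier G) := by
  have hn : Nat.card G * Nat.card G ≠ 0 := mul_ne_zero Nat.card_pos.ne' Nat.card_pos.ne'
  have : NeZero (Nat.card G * Nat.card G) := ⟨hn⟩
  choose c hc hcn using fun h : SchurMultiplier G =>
    exists_cocycle_pow_eq_one h hn (schurMultiplier_pow_eq_one h)
  let R := rootsOfUnity (Nat.card G * Nat.card G) ℂ
  let F : SchurMultiplier G → (G → G → R) × (G → G → R) := fun h =>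
    (fun x y => ⟨(c h).1.1 x y, (mem_rootsOfUnity _ _).2
        (congrFun₂ (congrArg (fun z : Z2 G ℂˣ => z.1.1) (hcn h)) x y)⟩,
      fun x y => ⟨(c h).1.2 x y, (mem_rootsOfUnity _ _).2
        (congrFun₂ (congrArg (fun z : Z2 G ℂˣ => z.1.2) (hcn h)) x y)⟩)
  refine Finite.of_injective F fun h h' e => ?_
  rw [← hc h, ← hc h']
  refine congrArg _ (Subtype.ext (Prod.ext (funext₂ fun x y => ?_) (funext₂ fun x y => ?_)))
  · exact congrArg Subtype.val (congrFun₂ (congrArg Prod.fst e) x y)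
  · exact congrArg Subtype.val (congrFun₂ (congrArg Prod.snd e) x y)

/-! ### Groups of roots of unity -/

theorem exists_mulEquiv_pi_rootsOfUnity (H : Type*) [CommGroup H] [Finite H] :
    ∃ (m : ℕ) (d : Fin m → ℕ), (∀ i, 0 < d i) ∧
      Nonempty ((∀ i, rootsOfUnity (d i) ℂ) ≃* H) := by
  obtain ⟨ι, _, n, hn, ⟨e⟩⟩ := CommGroup.equiv_prod_multiplicative_zmod_of_finite H
  let σ := Fintype.equivFin ι
  have hpos : ∀ j, 0 < n (σ.symm j) := fun j => zero_lt_one.trans (hn _)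
  refine ⟨Fintype.card ι, fun j => n (σ.symm j), hpos, ⟨?_⟩⟩
  let r : (∀ j, Multiplicative (ZMod (n (σ.symm j)))) ≃* ∀ i, Multiplicative (ZMod (n i)) :=
    { Equiv.piCongrLeft (fun i => Multiplicative (ZMod (n i))) σ.symm with
      map_mul' := fun f g => (Equiv.piCongrLeft _ σ.symm).symm.injective <| by
        ext; simp }
  refine (MulEquiv.piCongrRight fun j => ?_).trans (r.trans e.symm)
  have : NeZero (n (σ.symm j)) := ⟨(hpos j).ne'⟩
  refine mulEquivOfCyclicCardEq (?_ : Nat.card (rootsOfUnity (n (σ.symm j)) ℂ) = _)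
  · rw [Complex.card_rootsOfUnity]
    simp

/-- The character group of the group of `d`-th roots of unity consists of the powers. -/
theorem exists_map_eq_zpow_of_rootsOfUnity {d : ℕ} [NeZero d] (χ : rootsOfUnity d ℂ →* ℂˣ) :
    ∃ k : ℤ, ∀ a, χ a = (a : ℂˣ) ^ k := by
  have hmem : ∀ a, χ a ∈ rootsOfUnity d ℂ := fun a => by
    have ha : a ^ d = 1 := Subtype.ext a.2
    rw [mem_rootsOfUnity, ← map_pow, ha, map_one]
  obtain ⟨k, hk⟩ := MonoidHom.map_cyclic (χ.codRestrict _ hmem)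
  exact ⟨k, fun a => congrArg Subtype.val (hk a)⟩

/-! ### Stem extensions -/

section Extension

variable {G : Type*} [MultLieAlgebra G] {A : Type*} [CommGroup A]

theorem isCentralExtension_ext (c : Z2 G A) :
    IsCentralExtension (Ext.incl c) (Ext.proj c) where
  injective a b h := congrArg Ext.fib h
  surjective x := ⟨⟨1, x⟩, rfl⟩
  exact := by
    ext p
    rw [MonoidHom.mem_range, MonoidHom.mem_ker]
    constructor
    · rintro ⟨a, rfl⟩
      rfl
    · intro h
      exact ⟨p.fib, Ext.ext rfl (Eq.symm h)⟩
  central := by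
    rintro _ ⟨a, rfl⟩
    refine ⟨Subgroup.mem_center_iff.2 fun p => ?_, fun p => ?_⟩
    · refine Ext.ext ?_ ?_
      · change p.fib * a * c.1.1 p.base 1 = a * p.fib * c.1.1 1 p.base
        rw [(Ext.isCocycle c).one_left, (Ext.isCocycle c).one_right, mul_comm a]
      · change p.base * 1 = 1 * p.base
        rw [mul_one, one_mul]
    -- the Lie product of the extension depends only on the components in `G`
    · exact one_lieProd p

theorem lieProd_mem_mlDerived (x y : G) : x ⋆ y ∈ mlDerived G :=
  le_sup_left (a := lieSquare G) (Subgroup.mem_sInf.2 fun _ hH => hH.2 x y)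

/-- Transgression: a homomorphism `f` on the associated extension which is trivial on Lie products
turns the cocycle into a coboundary, through `g (x) = f (1, x)`. -/
theorem comp_incl_mem_B2 {B : Type*} [CommGroup B] (c : Z2 G A) (f : Ext c →* B)
    (hf : ∀ p q : Ext c, f (p ⋆ q) = 1) :
    ((fun x y => f (Ext.incl c (c.1.1 x y)), fun x y => f (Ext.incl c (c.1.2 x y))) :
      (G → G → B) × (G → G → B)) ∈ B2 G B := by
  have hsplit : ∀ (a : A) (x : G), f ⟨a, x⟩ = f (Ext.incl c a) * f ⟨1, x⟩ := by
    intro a x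
    rw [← map_mul]
    refine congrArg f (Ext.ext ?_ ?_)
    · change a = a * 1 * c.1.1 1 x
      rw [(Ext.isCocycle c).one_left, mul_one, mul_one]
    · exact (one_mul x).symm
  refine ⟨fun x => f ⟨1, x⟩, map_one f, fun x y => ?_, fun x y => ?_⟩
  · rw [eq_mul_inv_iff_mul_eq, ← hsplit, ← map_mul]
    refine congrArg f (Ext.ext ?_ rfl)
    change _ = 1 * 1 * c.1.1 x y
    rw [one_mul, one_mul]
  · rw [eq_inv_iff_mul_eq_one, ← hsplit]
    exact hf ⟨1, x⟩ ⟨1, y⟩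

/-- If no nontrivial character `χ` of `A` makes the pushed-out cocycle `χ ∘ c` a coboundary, the
extension associated with `c` is a stem extension: otherwise a character of the finite abelian
group `G* / ᴹ[G*, G*]` is nontrivial on the image of `A`. -/
theorem isStemExtension_ext [Finite G] [Finite A] (c : Z2 G A)
    (h : ∀ χ : A →* ℂˣ, ((fun x y => χ (c.1.1 x y), fun x y => χ (c.1.2 x y)) :
      (G → G → ℂˣ) × (G → G → ℂˣ)) ∈ B2 G ℂˣ → χ = 1) :
    IsStemExtension (Ext.incl c) (Ext.proj c) where
  toIsCentralExtension := isCentralExtension_ext c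
  stem := by
    rintro _ ⟨a, rfl⟩
    by_contra ha
    have : Finite (Ext c) :=
      Finite.of_injective (fun p => (p.fib, p.base)) fun p q e =>
        Ext.ext (congrArg Prod.fst e) (congrArg Prod.snd e)
    have hcomm : commutator (Ext c) ≤ mlDerived (Ext c) := le_sup_right
    have : (mlDerived (Ext c)).Normal := Subgroup.Normal.of_commutator_le _ hcomm
    let _ : CommGroup (Ext c ⧸ mlDerived (Ext c)) :=
      { (inferInstance : Group (Ext c ⧸ mlDerived (Ext c))) with
        mul_comm := (Subgroup.Normal.quotient_commutative_iff_commutator_le.2 hcomm).is_comm.comm }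
    have hne : (QuotientGroup.mk (Ext.incl c a) : Ext c ⧸ mlDerived (Ext c)) ≠ 1 := fun e =>
      ha ((QuotientGroup.eq_one_iff _).1 e)
    obtain ⟨φ, hφ⟩ :=
      CommGroup.exists_apply_ne_one_of_hasEnoughRootsOfUnity _ ℂ hne
    let f : Ext c →* ℂˣ := φ.comp (QuotientGroup.mk' (mlDerived (Ext c)))
    have hf : ∀ p q : Ext c, f (p ⋆ q) = 1 := fun p q =>
      (congrArg φ ((QuotientGroup.eq_one_iff _).2 (lieProd_mem_mlDerived p q))).trans (map_one φ)
    have := h (f.comp (Ext.incl c)) (comp_incl_mem_B2 c f hf)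
    exact hφ (DFunLike.congr_fun this a)

end Extension

theorem theoremC9 (G : Type u) [MultLieAlgebra G] [Finite G] :
    ∃ (m : ℕ) (d : Fin m → ℕ), (∀ i, 0 < d i) ∧
      ∃ c : MultLieAlgebra.Z2 G (∀ i : Fin m, rootsOfUnity (d i) ℂ),
        MultLieAlgebra.IsStemCover (MultLieAlgebra.Ext.incl c) (MultLieAlgebra.Ext.proj c) := by
  obtain ⟨m, d, hd, ⟨e⟩⟩ := exists_mulEquiv_pi_rootsOfUnity (SchurMultiplier G)
  have : ∀ i, NeZero (d i) := fun i => ⟨(hd i).ne'⟩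
  choose ζ hζ using fun i => IsCyclic.exists_generator (α := rootsOfUnity (d i) ℂ)
  have hζd : ∀ i, ζ i ^ d i = 1 := fun i => Subtype.ext (ζ i).2
  choose z hz hzd using fun i =>
    exists_cocycle_pow_eq_one (e (Pi.mulSingle i (ζ i))) (hd i).ne'
      (by rw [← map_pow, ← Pi.mulSingle_pow, hζd, Pi.mulSingle_one, map_one])
  let c : Z2 G (∀ i : Fin m, rootsOfUnity (d i) ℂ) :=
    ⟨(fun x y i => ⟨(z i).1.1 x y, (mem_rootsOfUnity _ _).2
        (congrFun₂ (congrArg (fun z : Z2 G ℂˣ => z.1.1) (hzd i)) x y)⟩,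
      fun x y i => ⟨(z i).1.2 x y, (mem_rootsOfUnity _ _).2
        (congrFun₂ (congrArg (fun z : Z2 G ℂˣ => z.1.2) (hzd i)) x y)⟩),
      isCocycle_of_forall_comp
        (fun i => (rootsOfUnity (d i) ℂ).subtype.comp (Pi.evalMonoidHom _ i))
        (fun a b h => funext fun i => Subtype.ext (h i)) fun i => (z i).2⟩
  refine ⟨m, d, hd, c, isStemExtension_ext c fun χ hχ => ?_, ⟨e⟩⟩
  choose k hk using fun i => exists_map_eq_zpow_of_rootsOfUnity
    (χ.comp (MonoidHom.mulSingle (fun i => rootsOfUnity (d i) ℂ) i))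
  have hχk : ∀ a, χ a = ∏ i, (a i : ℂˣ) ^ k i := fun a => by
    conv_lhs => rw [← Finset.univ_prod_mulSingle a, map_prod]
    exact Finset.prod_congr rfl fun i _ => hk i (a i)
  -- `χ ∘ c` is the product of the powers `z i ^ k i`, so the class
  -- `∏ i, e (mulSingle i (ζ i)) ^ k i` is trivial
  have hprod : ((∏ i, z i ^ k i : Z2 G ℂˣ) : (G → G → ℂˣ) × (G → G → ℂˣ)) =
      (fun x y => χ (c.1.1 x y), fun x y => χ (c.1.2 x y)) := by
    refine Prod.ext (funext₂ fun x y => ?_) (funext₂ fun x y => ?_)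
    · simp [hχk, c, Prod.fst_prod, Finset.prod_apply]
    · simp [hχk, c, Prod.snd_prod, Finset.prod_apply]
  have hone : e (∏ i, Pi.mulSingle i (ζ i ^ k i)) = 1 := by
    rw [map_prod]
    have : (QuotientGroup.mk (∏ i, z i ^ k i) : SchurMultiplier G) = 1 := by
      rw [QuotientGroup.eq_one_iff, Subgroup.mem_subgroupOf, hprod]
      exact hχ
    rw [← this, ← QuotientGroup.mk'_apply, map_prod]
    refine Finset.prod_congr rfl fun i _ => ?_
    rw [Pi.mulSingle_zpow, map_zpow, map_zpow, ← hz i, QuotientGroup.mk'_apply]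
  rw [Finset.univ_prod_mulSingle, map_eq_one_iff e e.injective] at hone
  refine MonoidHom.ext fun a => ?_
  rw [hχk]
  refine Finset.prod_eq_one fun i _ => ?_
  obtain ⟨l, hl⟩ := Subgroup.mem_zpowers_iff.1 (hζ i (a i))
  have h1 : ζ i ^ k i = 1 := congrFun hone i
  rw [← Subgroup.coe_zpow, ← hl, zpow_comm, h1, one_zpow]
  rfl
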